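/- Let $d\in\mathbb N$, $d\ge 1$, and let $\Omega=[0,1]^d$ be the $d$-dimensional torus (opposite points identified). Let $H^1(\Omega)$ be the space of $u\in L^2(\Omega)$ whose weak partial derivatives lie in $L^2(\Omega)$, with norm $\|u\|_{L^2}+\sum_i\|D_iu\|_{L^2}$, and let $H^{-1}(\Omega)=(H^1(\Omega))^*$ with the dual norm $\|f\|_{H^{-1}}=\sup\{|\langle f,\psi\rangle_{L^2}|:\psi\in H^1(\Omega),\ \|\psi\|_{H^1}\le 1\}$. Let $C^1(\Omega)$ be the continuously differentiable functions on $\Omega$, with norm $\|v\|_{\infty}+\sum_i\|\partial_iv\|_\infty$. Let $C^1([0,T],C^1(\Omega))$ be the space of weakly differentiable maps $V:[0,T]\to C^1(\Omega)$ for which $$\|V\|_{C^1([0,T],C^1)}=\sup_{0<t<T}\|V(t)\|_{C^1(\Omega)}+\operatorname*{ess\,sup}_{0<t<T}\|V'(t)\|_{C^1(\Omega)}<\infty.$$ For every $T>0$ and $M\ge 0$ there exists a constant $c=c(M,T,d)>0$ such that the following holds. Let $V$ satisfy $\|V\|_{C^1([0,T],C^1)}\le M$, let $h\in H^1(\Omega)$,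 and let $U_h$ be a weak solution of $$\frac{\partial}{\partial t}U-\Delta U-VU=0\ \text{ on }(0,T]\times\Omega,\qquad U(0,\cdot)=h,$$ that is, $U_h\in L^2([0,T],H^1(\Omega))\cap C([0,T],L^2(\Omega))$ has a weak time derivative $U_h'\in L^2([0,T],H^{-1}(\Omega))$, $U_h(0)=h$, and for all $v\in H^1(\Omega)$ and a.e. $t\in[0,T]$, $$\langle U_h'(t),v\rangle_{L^2}+\langle\nabla U_h(t),\nabla v\rangle_{L^2}-\langle V(t,\cdot)U_h(t),v\rangle_{L^2}=0,$$ where $\langle U_h'(t),v\rangle_{L^2}$ denotes the action of $U_h'(t)\in H^{-1}(\Omega)$ on $v$. Then $$\int_0^T\|U_h(s)\|_{L^2(\Omega)}^2\,ds\ \ge\ c\,\|h\|_{H^{-1}}^2 .$$ -/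

import Mathlib

open MeasureTheory Set
open scoped ENNReal NNReal ContDiff

noncomputable section

namespace TorusParabolic

/-! ## The torus and `L²` -/

/-- The `d`-dimensional torus `Ω = [0,1]^d` with opposite points identified. -/
abbrev Torus (d : ℕ) : Type := UnitAddTorus (Fin d)

/-- Lebesgue measure on the torus: the product of the normalised (total mass one) Haar measures on
the circle `ℝ / ℤ`. -/
def vol (d : ℕ) : Measure (Torus d) := Measure.pi fun _ => AddCircle.haarAddCircle

instance (d : ℕ) : IsProbabilityMeasure (vol d) := by
  unfold vol; infer_instance

/-- The real space `L²(Ω)`. -/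
abbrev L2 (d : ℕ) : Type := Lp ℝ 2 (vol d)

/-! ## Partial derivatives and test functions -/

/-- `s ↦ f (x + s eᵢ)`. -/
def line {d : ℕ} (f : Torus d → ℝ) (i : Fin d) (x : Torus d) : ℝ → ℝ :=
  fun s => f (x + Pi.single i (s : UnitAddCircle))

/-- The classical partial derivative `∂ᵢ f (x)`. -/
def pderiv {d : ℕ} (i : Fin d) (f : Torus d → ℝ) (x : Torus d) : ℝ :=
  deriv (line f i x) 0

/-- The projection `ℝ^d → Ω`. -/
def proj (d : ℕ) (y : Fin d → ℝ) : Torus d := fun i => (y i : UnitAddCircle)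

/-- `φ ∈ C^∞(Ω)`: the periodic function on `ℝ^d` which `φ` represents is smooth. -/
def IsSmooth {d : ℕ} (φ : Torus d → ℝ) : Prop := ContDiff ℝ ∞ (φ ∘ proj d)

theorem isOpenQuotientMap_proj (d : ℕ) : IsOpenQuotientMap (proj d) :=
  IsOpenQuotientMap.piMap (f := fun (_ : Fin d) (y : ℝ) => (y : UnitAddCircle))
    fun _ => QuotientAddGroup.isOpenQuotientMap_mk

theorem proj_add_single {d : ℕ} (y : Fin d → ℝ) (i : Fin d) (s : ℝ) :
    proj d (y + s • Pi.single i 1) = proj d y + Pi.single i (s : UnitAddCircle) := by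
  funext j
  by_cases h : j = i
  · subst h; simp [proj]
  · simp [proj, h]

theorem IsSmooth.continuous {d : ℕ} {φ : Torus d → ℝ} (hφ : IsSmooth φ) : Continuous φ :=
  (isOpenQuotientMap_proj d).isQuotientMap.continuous_iff.2 (ContDiff.continuous hφ)

theorem IsSmooth.continuous_pderiv {d : ℕ} {φ : Torus d → ℝ} (hφ : IsSmooth φ) (i : Fin d) :
    Continuous (pderiv i φ) := by
  refine (isOpenQuotientMap_proj d).isQuotientMap.continuous_iff.2 ?_
  have hd : Differentiable ℝ (φ ∘ proj d) := ContDiff.differentiable hφ (by simp)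
  have h : pderiv i φ ∘ proj d = fun y => fderiv ℝ (φ ∘ proj d) y (Pi.single i 1) := by
    funext y
    have h1 : line φ i (proj d y) = fun s : ℝ => (φ ∘ proj d) (y + s • Pi.single i 1) := by
      funext s
      simp [line, proj_add_single]
    have h2 := ((hd y).hasFDerivAt.hasLineDerivAt (Pi.single i 1)).lineDeriv
    simp only [lineDeriv] at h2
    simp only [Function.comp, pderiv, h1]
    exact h2
  rw [h]
  exact (ContDiff.continuous_fderiv hφ (by simp)).clm_apply continuous_const

theorem integrable_mul_of_continuous {d : ℕ} (f : L2 d) {φ : Torus d → ℝ} (hφ : Continuous φ) :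
    Integrable (fun x => f x * φ x) (vol d) := by
  have h1 : Integrable f (vol d) := (Lp.memLp f).integrable (by norm_num)
  obtain ⟨C, hC⟩ := isCompact_univ.exists_bound_of_continuousOn (hφ.continuousOn (s := univ))
  exact h1.mul_bdd (c := C) hφ.aestronglyMeasurable (by simp_all)

/-! ## The space `H¹(Ω)` and its dual `H⁻¹(Ω)` -/

/-- `g` is the weak partial derivative `Dᵢ f` on the torus. -/
def IsWeakPDeriv {d : ℕ} (i : Fin d) (f g : L2 d) : Prop :=
  ∀ φ : Torus d → ℝ, IsSmooth φ →
    ∫ x, f x * pderiv i φ x ∂(vol d) = -∫ x, g x * φ x ∂(vol d)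

/-- `H¹(Ω)`, the space of all `f ∈ L²(Ω)` with weak partial derivatives `D₁ f, …, D_d f ∈ L²(Ω)`.
An element is stored together with its (unique) weak partial derivatives, as
`(f, (D₁ f, …, D_d f))`, and the inherited norm is `‖f‖_{L²} + ∑ᵢ ‖Dᵢ f‖_{L²}`. -/
def H1 (d : ℕ) : Submodule ℝ (WithLp 1 (L2 d × PiLp 1 (fun _ : Fin d => L2 d))) where
  carrier := {u | ∀ i, IsWeakPDeriv i u.fst (u.snd i)}
  zero_mem' := by
    intro i φ _
    have h : ∀ ψ : Torus d → ℝ, ∫ x, (0 : L2 d) x * ψ x ∂(vol d) = 0 := fun ψ => by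
      rw [← integral_zero (Torus d) ℝ (μ := vol d)]
      refine integral_congr_ae ?_
      filter_upwards [Lp.coeFn_zero ℝ 2 (vol d)] with x hx
      simp only [hx, Pi.zero_apply, zero_mul]
    simp only [WithLp.zero_fst, WithLp.zero_snd, PiLp.zero_apply, h, neg_zero]
  add_mem' := by
    intro u v hu hv i φ hφ
    have h : ∀ (f g : L2 d) (ψ : Torus d → ℝ), Continuous ψ → ∫ x, (f + g : L2 d) x * ψ x ∂(vol d)
        = ∫ x, f x * ψ x ∂(vol d) + ∫ x, g x * ψ x ∂(vol d) := fun f g ψ hψ => by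
      rw [← integral_add (integrable_mul_of_continuous f hψ) (integrable_mul_of_continuous g hψ)]
      refine integral_congr_ae ?_
      filter_upwards [Lp.coeFn_add f g] with x hx
      simp only [hx, Pi.add_apply, add_mul]
    simp only [WithLp.add_fst, WithLp.add_snd, PiLp.add_apply]
    rw [h _ _ _ (hφ.continuous_pderiv i), h _ _ _ hφ.continuous, hu i φ hφ, hv i φ hφ]
    ring
  smul_mem' := by
    intro c u hu i φ hφ
    have h : ∀ (f : L2 d) (ψ : Torus d → ℝ), ∫ x, (c • f : L2 d) x * ψ x ∂(vol d)
        = c * ∫ x, f x * ψ x ∂(vol d) := fun f ψ => by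
      rw [← integral_const_mul]
      refine integral_congr_ae ?_
      filter_upwards [Lp.coeFn_smul c f] with x hx
      simp only [hx, Pi.smul_apply, smul_eq_mul, mul_assoc]
    simp only [WithLp.smul_fst, WithLp.smul_snd, PiLp.smul_apply]
    rw [h, h, hu i φ hφ]
    ring

/-- The inclusion `H¹(Ω) → L²(Ω)`. -/
def H1.toL2 {d : ℕ} : H1 d →L[ℝ] L2 d :=
  (WithLp.fstL 1 ℝ (L2 d) (PiLp 1 (fun _ : Fin d => L2 d))).comp (H1 d).subtypeL

/-- The weak partial derivative `Dᵢ u` of `u ∈ H¹(Ω)`. -/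
def H1.grad {d : ℕ} (u : H1 d) (i : Fin d) : L2 d := u.1.snd i

theorem H1.norm_eq {d : ℕ} (u : H1 d) : ‖u‖ = ‖H1.toL2 u‖ + ∑ i, ‖H1.grad u i‖ := by
  rw [← Submodule.norm_coe, WithLp.prod_norm_eq_of_L1, PiLp.norm_eq_of_L1]
  rfl

/-- `H⁻¹(Ω) = (H¹(Ω))*` with the dual norm `‖F‖ = sup {|F ψ| : ψ ∈ H¹, ‖ψ‖_{H¹} ≤ 1}`. -/
abbrev Hneg1 (d : ℕ) : Type := StrongDual ℝ (H1 d)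

/-- `f ∈ L²(Ω)` as the element `ψ ↦ ⟨f, ψ⟩_{L²}` of `H⁻¹(Ω)`. -/
def toHneg1 {d : ℕ} (f : L2 d) : Hneg1 d := (innerSL ℝ f).comp H1.toL2

/-! ## The space `C¹(Ω)` -/

/-- `C¹(Ω)`: continuous functions with continuous first partial derivatives. An element is stored
together with its partial derivatives, as `(f, (∂₁ f, …, ∂_d f))`, and the inherited norm is
`‖f‖_∞ + ∑ᵢ ‖∂ᵢ f‖_∞`. -/
def C1 (d : ℕ) : Submodule ℝ (WithLp 1 (C(Torus d, ℝ) × PiLp 1 (fun _ : Fin d => C(Torus d, ℝ)))) where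
  carrier := {v | ∀ i x, HasDerivAt (line v.fst i x) (v.snd i x) 0}
  zero_mem' := by
    intro i x
    exact hasDerivAt_const (0 : ℝ) (0 : ℝ)
  add_mem' := by
    intro u v hu hv i x
    exact (hu i x).add (hv i x)
  smul_mem' := by
    intro c u hu i x
    exact (hu i x).const_smul c

/-- The function underlying an element of `C¹(Ω)`. -/
def C1.toFun {d : ℕ} (v : C1 d) : C(Torus d, ℝ) := v.1.fst

theorem C1.norm_eq {d : ℕ} (v : C1 d) : ‖v‖ = ‖C1.toFun v‖ + ∑ i, ‖v.1.snd i‖ := by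
  rw [← Submodule.norm_coe, WithLp.prod_norm_eq_of_L1, PiLp.norm_eq_of_L1]
  rfl

theorem C1.hasDerivAt_line {d : ℕ} (v : C1 d) (i : Fin d) (x : Torus d) (s : ℝ) :
    HasDerivAt (line v.1.fst i x) (v.1.snd i (x + Pi.single i (s : UnitAddCircle))) s := by
  have h := v.2 i (x + Pi.single i (s : UnitAddCircle))
  have h' := HasDerivAt.comp_sub_const (f := line v.1.fst i (x + Pi.single i (s : UnitAddCircle)))
    s s (by simpa using h)
  have he : (fun r => line v.1.fst i (x + Pi.single i (s : UnitAddCircle)) (r - s))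
      = line v.1.fst i x := by
    funext r
    simp only [line, add_assoc, ← Pi.single_add, ← AddCircle.coe_add, add_sub_cancel]
  rwa [he] at h'

/-- `C¹(Ω)` is a Banach space (so that the integrals of `C¹(Ω)`-valued maps below are genuine). -/
instance (d : ℕ) : CompleteSpace (C1 d) := by
  have hcl : IsClosed (C1 d : Set (WithLp 1 (C(Torus d, ℝ) × PiLp 1
      (fun _ : Fin d => C(Torus d, ℝ))))) := by
    refine isClosed_of_closure_subset fun v hv => ?_
    obtain ⟨w, hw, hlim⟩ := mem_closure_iff_seq_limit.1 hv
    intro i x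
    have h1 : Filter.Tendsto (fun n => (w n).fst) Filter.atTop (nhds v.fst) :=
      ((WithLp.fstL 1 ℝ _ _).continuous.tendsto v).comp hlim
    have h2 : Filter.Tendsto (fun n => (w n).snd i) Filter.atTop (nhds (v.snd i)) :=
      (((PiLp.continuous_apply 1 _ i).comp (WithLp.sndL 1 ℝ _ _).continuous).tendsto v).comp hlim
    have hc : Continuous fun s : ℝ => x + Pi.single i (s : UnitAddCircle) :=
      continuous_const.add ((continuous_single i).comp (AddCircle.continuous_mk' 1))
    have h3 := hasDerivAt_of_tendstoUniformly (l := Filter.atTop)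
      (f := fun n => line (w n).fst i x)
      (f' := fun n s => (w n).snd i (x + Pi.single i (s : UnitAddCircle)))
      (g := line v.fst i x)
      (g' := fun s => v.snd i (x + Pi.single i (s : UnitAddCircle)))
      ((ContinuousMap.tendsto_iff_tendstoUniformly.1 h2).comp
        fun s : ℝ => x + Pi.single i (s : UnitAddCircle))
      (Filter.Eventually.of_forall fun n s => C1.hasDerivAt_line ⟨w n, hw n⟩ i x s)
      (fun s => ((ContinuousMap.tendsto_iff_tendstoUniformly.1 h1).tendsto_at _)) 0
    simpa using h3
  exact hcl.completeSpace_coe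

/-! ## Weak derivatives in time -/

/-- `H'` is the weak (distributional) derivative on `(0,T)` of `H : (0,T) → X`, for a Banach
space `X`. -/
def IsWeakTimeDeriv {X : Type*} [NormedAddCommGroup X] [NormedSpace ℝ X] (T : ℝ)
    (H H' : ℝ → X) : Prop :=
  LocallyIntegrableOn H (Ioo 0 T) ∧ LocallyIntegrableOn H' (Ioo 0 T) ∧
    ∀ ψ : ℝ → ℝ, ContDiff ℝ ∞ ψ → HasCompactSupport ψ → tsupport ψ ⊆ Ioo 0 T →
      ∫ t in Ioo 0 T, deriv ψ t • H t = -∫ t in Ioo 0 T, ψ t • H' t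

/-- `‖H‖_{C¹([0,T],X)} ≤ M`, where `C¹([0,T],X)` consists of the weakly differentiable maps `H` for
which `‖H‖_{C¹([0,T],X)} = sup_{0<t<T} ‖H t‖_X + ess sup_{0<t<T} ‖H' t‖_X` is finite. -/
def C1TimeNormLE {X : Type*} [NormedAddCommGroup X] [NormedSpace ℝ X] (T : ℝ) (H : ℝ → X)
    (M : ℝ≥0) : Prop :=
  ∃ H' : ℝ → X, IsWeakTimeDeriv T H H' ∧
    (⨆ t ∈ Ioo 0 T, ‖H t‖ₑ) + essSup (fun t => ‖H' t‖ₑ) (volume.restrict (Ioo 0 T)) ≤ (M : ℝ≥0∞)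

/-! ## Weak solutions of `∂ₜ U - Δ U - V U = 0`, `U(0) = h` -/

/-- `U` is a weak solution on `[0,T]` of `∂ₜ U - Δ U - V U = 0`, `U(0) = h`:
`U ∈ L²([0,T], H¹) ∩ C([0,T], L²)` with `U' ∈ L²([0,T], H⁻¹)`, `U(0) = h`, and
`⟨U', v⟩ + ⟨∇U, ∇v⟩ - ⟨V(t,·) U, v⟩ = 0` for all `v ∈ H¹` and a.e. `t ∈ [0,T]`.
Here `u` is `U` as a map into `H¹(Ω)`. -/
structure IsWeakSolution {d : ℕ} (T : ℝ) (V : ℝ → C1 d) (h : H1 d) (U : ℝ → L2 d) : Prop where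
  continuousOn : ContinuousOn U (Icc 0 T)
  initial : U 0 = H1.toL2 h
  weak : ∃ (u : ℝ → H1 d) (U' : ℝ → Hneg1 d),
    (∀ᵐ t ∂(volume.restrict (Ioo 0 T)), H1.toL2 (u t) = U t) ∧
    MemLp u 2 (volume.restrict (Ioo 0 T)) ∧
    MemLp U' 2 (volume.restrict (Ioo 0 T)) ∧
    IsWeakTimeDeriv T (fun t => toHneg1 (U t)) U' ∧
    ∀ v : H1 d, ∀ᵐ t ∂(volume.restrict (Ioo 0 T)),
      U' t v + ∑ i, inner ℝ (H1.grad (u t) i) (H1.grad v i)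
        - ∫ x, C1.toFun (V t) x * U t x * H1.toL2 v x ∂(vol d) = 0

end TorusParabolic

end

/-!
Only the trigonometric coefficients of `U` enter the argument. Let `l = ∑ᵢ (2π kᵢ)²` be the
eigenvalue of `-Δ` on the cosine and the sine of frequency `k`, let `f` be the coefficient of `U`
along one of them and `b` the coefficient of `V U`. The weak formulation, tested with this mode, says
that `f' = -l f + b` weakly in time (`IsWeakSolution.exists_forcing`). Multiplying by
`η(t) exp (-l t)`, where `η` is a cutoff with `η(0) = 1` that vanishes near `T`, and integrating by
parts gives
`f(0) = ∫ (2 l η - η') exp (-l t) f dt - ∫ η exp (-l t) b dt`.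
Since `∫ l² exp (-2 l t) dt ≤ l / 2`, the Cauchy-Schwarz inequality yields
`f(0)² ≤ C (1 + l) (∫ f² + ∫ b²)` with `C` depending on `T` only (`exists_sq_initial_le`): the weight
exponential in time is what produces the factor `1 + l` of the `H⁻¹` norm instead of `1 + l²`.

Dividing by `1 + l`, summing over all modes and using Bessel's inequality for `U(t)` and for
`V(t) U(t)` bounds `∑ ĥ(k)² / (1 + l_k)` by `C (1 + M²) ∫ ‖U‖²` (`exists_sum_sq_initial_div_le`).
This sum dominates the square of the dual norm of `h` (`norm_toHneg1_sq_le`), because every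
`ψ ∈ H¹(Ω)` satisfies `∑ (1 + l_k) ψ̂(k)² ≤ ‖ψ‖²`: the coefficients of the weak derivative `Dᵢ ψ` are
those of `ψ` multiplied by `± 2π kᵢ` (`sum_eigenvalue_mul_inner_modeL2_sq_le`).
-/

noncomputable section

namespace TorusParabolic

open Filter Topology
open scoped ComplexConjugate Real
open Real (smoothTransition)

/-! ### Real Fourier series on the torus -/

/-- The Hilbert basis `e_k(x) = exp (2πi k·x)` of complex-valued `L²(Ω)`. -/
def fourierBasis (d : ℕ) : HilbertBasis (Fin d → ℤ) ℂ (Lp ℂ 2 (vol d)) :=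
  UnitAddTorus.mFourierBasis (d := Fin d)

theorem coeFn_fourierBasis {d : ℕ} (k : Fin d → ℤ) :
    fourierBasis d k =ᵐ[vol d] UnitAddTorus.mFourier k := by
  have h : fourierBasis d k = ContinuousMap.toLp (E := ℂ) 2 (vol d) ℂ (UnitAddTorus.mFourier k) :=
    congrFun (UnitAddTorus.coe_mFourierBasis (d := Fin d)) k
  rw [h]
  exact ContinuousMap.coeFn_toLp (vol d) _

/-- The real trigonometric mode `x ↦ Re (z̄ exp (2πi k·x))`. It is the cosine of frequency `k` for
`z = 1` and the sine for `z = i`. -/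
def mode {d : ℕ} (z : ℂ) (k : Fin d → ℤ) : C(Torus d, ℝ) where
  toFun x := (conj z * UnitAddTorus.mFourier k x).re
  continuous_toFun := by fun_prop

/-- The trigonometric mode as an element of `L²(Ω)`. -/
def modeL2 {d : ℕ} (z : ℂ) (k : Fin d → ℤ) : L2 d := ContinuousMap.toLp 2 (vol d) ℝ (mode z k)

theorem coeFn_modeL2 {d : ℕ} (z : ℂ) (k : Fin d → ℤ) : modeL2 z k =ᵐ[vol d] mode z k :=
  ContinuousMap.coeFn_toLp (vol d) _

theorem inner_modeL2 {d : ℕ} (f : L2 d) (z : ℂ) (k : Fin d → ℤ) :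
    inner ℝ f (modeL2 z k) = ∫ x, f x * mode z k x ∂(vol d) := by
  rw [MeasureTheory.L2.inner_def]
  refine integral_congr_ae ?_
  filter_upwards [coeFn_modeL2 z k] with x hx
  rw [hx, Real.inner_apply]

/-- A real-valued `L²` function, regarded as a complex-valued one. -/
def ofRealL2 {d : ℕ} (f : L2 d) : Lp ℂ 2 (vol d) := Complex.ofRealCLM.compLp f

theorem coeFn_ofRealL2 {d : ℕ} (f : L2 d) : ofRealL2 f =ᵐ[vol d] fun x => (f x : ℂ) :=
  Complex.ofRealCLM.coeFn_compLp f

theorem inner_ofRealL2 {d : ℕ} (f g : L2 d) :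
    inner ℂ (ofRealL2 f) (ofRealL2 g) = ((inner ℝ f g : ℝ) : ℂ) := by
  rw [MeasureTheory.L2.inner_def, MeasureTheory.L2.inner_def, ← integral_complex_ofReal]
  refine integral_congr_ae ?_
  filter_upwards [coeFn_ofRealL2 f, coeFn_ofRealL2 g] with x hf hg
  simp [hf, hg]

theorem inner_modeL2_eq_re {d : ℕ} (f : L2 d) (z : ℂ) (k : Fin d → ℤ) :
    inner ℝ f (modeL2 z k) = (conj z * inner ℂ (ofRealL2 f) (fourierBasis d k)).re := by
  rw [inner_modeL2, MeasureTheory.L2.inner_def]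
  have hi := MeasureTheory.L2.integrable_inner (𝕜 := ℂ) (ofRealL2 f) (fourierBasis d k)
  rw [← integral_const_mul]
  have h := integral_re (hi.const_mul (conj z))
  simp only [RCLike.re_eq_complex_re] at h
  rw [← h]
  refine integral_congr_ae ?_
  filter_upwards [coeFn_ofRealL2 f, coeFn_fourierBasis k] with x hf hk
  simp [hf, hk, mode]
  ring

/-- Parseval's identity in terms of real trigonometric modes. -/
theorem hasSum_inner_modeL2 {d : ℕ} (f g : L2 d) :
    HasSum (fun k => inner ℝ f (modeL2 1 k) * inner ℝ g (modeL2 1 k) +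
      inner ℝ f (modeL2 Complex.I k) * inner ℝ g (modeL2 Complex.I k)) (inner ℝ f g) := by
  have h := Complex.hasSum_re ((fourierBasis d).hasSum_inner_mul_inner (ofRealL2 f) (ofRealL2 g))
  rw [inner_ofRealL2, Complex.ofReal_re] at h
  convert h using 2 with k
  rw [← inner_conj_symm (fourierBasis d k)]
  simp only [inner_modeL2_eq_re, map_one, one_mul, Complex.conj_I, Complex.mul_re, Complex.neg_re,
    Complex.neg_im, Complex.I_re, Complex.I_im, Complex.conj_re, Complex.conj_im]
  ring

/-- Bessel's inequality in terms of real trigonometric modes. -/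
theorem sum_inner_modeL2_sq_le {d : ℕ} (f : L2 d) (F : Finset (Fin d → ℤ)) :
    ∑ k ∈ F, (inner ℝ f (modeL2 1 k) ^ 2 + inner ℝ f (modeL2 Complex.I k) ^ 2) ≤ ‖f‖ ^ 2 := by
  have h := hasSum_inner_modeL2 f f
  rw [real_inner_self_eq_norm_sq] at h
  simp only [← sq] at h
  exact sum_le_hasSum F (fun k _ => by positivity) h

/-! ### Trigonometric modes as elements of `H¹(Ω)` -/

theorem mFourier_add_single {d : ℕ} (k : Fin d → ℤ) (x : Torus d) (i : Fin d) (s : ℝ) :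
    UnitAddTorus.mFourier k (x + Pi.single i (s : UnitAddCircle))
      = UnitAddTorus.mFourier k x * Complex.exp (2 * π * Complex.I * k i * s) := by
  have hsingle : (fourier (k i) (s : UnitAddCircle) : ℂ)
      = ∏ j, fourier (k j) ((Pi.single i (s : UnitAddCircle) : Torus d) j) := by
    rw [Finset.prod_eq_single i (fun j _ hj => by simp [hj]) (by simp), Pi.single_eq_same]
  have hexp : Complex.exp (2 * π * Complex.I * k i * s) = fourier (k i) (s : UnitAddCircle) := by
    rw [fourier_coe_apply]
    simp
  rw [hexp, hsingle]
  simp only [UnitAddTorus.mFourier, ContinuousMap.coe_mk, ← Finset.prod_mul_distrib]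
  refine Finset.prod_congr rfl fun j _ => ?_
  simp only [Pi.add_apply, fourier_apply, smul_add, AddCircle.toCircle_add, Circle.coe_mul]

theorem mode_apply {d : ℕ} (z : ℂ) (k : Fin d → ℤ) (x : Torus d) :
    mode z k x = (conj z * UnitAddTorus.mFourier k x).re := rfl

theorem mode_neg {d : ℕ} (z : ℂ) (k : Fin d → ℤ) : mode (-z) k = -mode z k := by
  ext x
  simp [mode_apply]

theorem modeL2_neg {d : ℕ} (z : ℂ) (k : Fin d → ℤ) : modeL2 (-z) k = -modeL2 z k := by
  simp only [modeL2, mode_neg, map_neg]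

/-- Differentiating a mode multiplies it by `2π kᵢ` and turns its phase `z` into `-i z`. -/
theorem hasDerivAt_line_mode {d : ℕ} (z : ℂ) (k : Fin d → ℤ) (i : Fin d) (x : Torus d) :
    HasDerivAt (line (mode z k) i x) (2 * π * k i * mode (-Complex.I * z) k x) 0 := by
  have h1 : HasDerivAt (fun s : ℝ => conj z * (UnitAddTorus.mFourier k x
      * Complex.exp (2 * π * Complex.I * k i * s)))
      (conj z * (UnitAddTorus.mFourier k x * (2 * π * Complex.I * k i))) 0 := by
    have := (((hasDerivAt_id (0 : ℝ)).ofReal_comp.const_mul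
      (2 * π * Complex.I * k i)).cexp.const_mul (UnitAddTorus.mFourier k x)).const_mul (conj z)
    simpa using this
  have h2 := Complex.reCLM.hasFDerivAt.comp_hasDerivAt (0 : ℝ) h1
  have hline : line (mode z k) i x = Complex.reCLM ∘ fun s : ℝ => conj z *
      (UnitAddTorus.mFourier k x * Complex.exp (2 * π * Complex.I * k i * s)) := by
    funext s
    simp only [line, mode_apply, mFourier_add_single, Function.comp, Complex.reCLM_apply]
  have hval : conj z * (UnitAddTorus.mFourier k x * (2 * π * Complex.I * k i))
      = ((2 * π * k i : ℝ) : ℂ) * (conj (-Complex.I * z) * UnitAddTorus.mFourier k x) := by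
    simp
    ring
  rw [hval, Complex.reCLM_apply, Complex.re_ofReal_mul, ← hline] at h2
  exact h2

theorem pderiv_mode {d : ℕ} (z : ℂ) (k : Fin d → ℤ) (i : Fin d) (x : Torus d) :
    pderiv i (mode z k) x = 2 * π * k i * mode (-Complex.I * z) k x :=
  (hasDerivAt_line_mode z k i x).deriv

theorem isSmooth_mode {d : ℕ} (z : ℂ) (k : Fin d → ℤ) : IsSmooth (mode z k) := by
  have h : ContDiff ℝ ∞ fun y : Fin d → ℝ =>
      conj z * ∏ i, Complex.exp (2 * π * Complex.I * k i * (y i : ℂ)) := by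
    refine contDiff_const.mul (contDiff_prod fun i _ => ContDiff.cexp ?_)
    exact contDiff_const.mul (Complex.ofRealCLM.contDiff.comp (contDiff_apply ℝ ℝ i))
  have h2 := Complex.reCLM.contDiff.comp h
  have he : mode z k ∘ proj d = Complex.reCLM ∘ fun y : Fin d → ℝ =>
      conj z * ∏ i, Complex.exp (2 * π * Complex.I * k i * (y i : ℂ)) := by
    funext y
    simp only [mode_apply, proj, UnitAddTorus.mFourier, ContinuousMap.coe_mk, Function.comp,
      Complex.reCLM_apply, fourier_coe_apply]
    simp
  rwa [IsSmooth, he]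

theorem IsSmooth.hasDerivAt_line {d : ℕ} {φ : Torus d → ℝ} (hφ : IsSmooth φ) (i : Fin d)
    (x : Torus d) : HasDerivAt (line φ i x) (pderiv i φ x) 0 := by
  obtain ⟨y, rfl⟩ := (isOpenQuotientMap_proj d).surjective x
  have hd : Differentiable ℝ (φ ∘ proj d) := ContDiff.differentiable hφ (by simp)
  have h1 : line φ i (proj d y) = fun s : ℝ => (φ ∘ proj d) (y + s • Pi.single i 1) := by
    funext s
    simp [line, proj_add_single]
  have h2 := (hd y).lineDifferentiableAt (v := Pi.single i 1)
  refine DifferentiableAt.hasDerivAt ?_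
  rw [h1]
  exact h2

/-- A derivative of a periodic function has mean zero: along each coordinate circle it integrates
to zero, and averaging over the starting point does not change its mean. -/
theorem integral_eq_zero_of_hasDerivAt_line {d : ℕ} {f f' : Torus d → ℝ} (hf' : Continuous f')
    (i : Fin d) (h : ∀ x, HasDerivAt (line f i x) (f' x) 0) : ∫ x, f' x ∂(vol d) = 0 := by
  have : (vol d).IsAddRightInvariant := by unfold vol; infer_instance
  have hline (x : Torus d) (s : ℝ) :
      HasDerivAt (line f i x) (f' (x + Pi.single i (s : UnitAddCircle))) s := by
    have h' := HasDerivAt.comp_sub_const (f := line f i (x + Pi.single i (s : UnitAddCircle)))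
      s s (by simpa using h _)
    have he : (fun r => line f i (x + Pi.single i (s : UnitAddCircle)) (r - s))
        = line f i x := by
      funext r
      simp only [line, add_assoc, ← Pi.single_add, ← AddCircle.coe_add, add_sub_cancel]
    rwa [he] at h'
  have hcont : Continuous fun p : Torus d × ℝ => f' (p.1 + Pi.single i (p.2 : UnitAddCircle)) :=
    hf'.comp (continuous_fst.add ((continuous_single i).comp
      ((AddCircle.continuous_mk' 1).comp continuous_snd)))
  have hx (x : Torus d) : ∫ s in Ioc (0 : ℝ) 1, f' (x + Pi.single i (s : UnitAddCircle)) = 0 := by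
    rw [← intervalIntegral.integral_of_le zero_le_one,
      intervalIntegral.integral_eq_sub_of_hasDerivAt (fun s _ => hline x s)
        ((hcont.comp (Continuous.prodMk_right x)).intervalIntegrable _ _)]
    have : ((1 : ℝ) : UnitAddCircle) = 0 := AddCircle.coe_period 1
    simp [line, this]
  obtain ⟨C, hC⟩ := isCompact_univ.exists_bound_of_continuousOn (hf'.continuousOn (s := univ))
  have hint : Integrable
      (Function.uncurry fun (x : Torus d) (s : ℝ) => f' (x + Pi.single i (s : UnitAddCircle)))
      ((vol d).prod (volume.restrict (Ioc (0 : ℝ) 1))) :=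
    Integrable.of_bound hcont.aestronglyMeasurable C (by simp_all [Function.uncurry])
  have hswap := integral_integral_swap hint
  simp only [hx, integral_zero] at hswap
  have hinv (s : ℝ) : ∫ x, f' (x + Pi.single i (s : UnitAddCircle)) ∂(vol d)
      = ∫ x, f' x ∂(vol d) := integral_add_right_eq_self f' _
  simp only [hinv] at hswap
  simpa using hswap.symm

theorem isWeakPDeriv_modeL2 {d : ℕ} (z : ℂ) (k : Fin d → ℤ) (i : Fin d) :
    IsWeakPDeriv i (modeL2 z k) ((2 * π * k i) • modeL2 (-Complex.I * z) k) := by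
  intro φ hφ
  have h1 : ∫ x, modeL2 z k x * pderiv i φ x ∂(vol d)
      = ∫ x, mode z k x * pderiv i φ x ∂(vol d) := by
    refine integral_congr_ae ?_
    filter_upwards [coeFn_modeL2 z k] with x hx
    rw [hx]
  have h2 : ∫ x, ((2 * π * k i) • modeL2 (-Complex.I * z) k : L2 d) x * φ x ∂(vol d)
      = ∫ x, 2 * π * k i * mode (-Complex.I * z) k x * φ x ∂(vol d) := by
    refine integral_congr_ae ?_
    filter_upwards [coeFn_modeL2 (-Complex.I * z) k,
      Lp.coeFn_smul (2 * π * k i : ℝ) (modeL2 (-Complex.I * z) k)] with x hx hx'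
    rw [hx', Pi.smul_apply, hx, smul_eq_mul]
  have hc1 : Continuous fun x => mode z k x * pderiv i φ x :=
    (mode z k).continuous.mul (hφ.continuous_pderiv i)
  have hc2 : Continuous fun x => 2 * π * k i * mode (-Complex.I * z) k x * φ x :=
    (continuous_const.mul (mode _ k).continuous).mul hφ.continuous
  have h3 := integral_eq_zero_of_hasDerivAt_line (hc2.add hc1) i
    (f := fun x => mode z k x * φ x) fun x => by
      have := (hasDerivAt_line_mode z k i x).fun_mul (hφ.hasDerivAt_line i x)
      simpa [line] using! this
  simp only [Pi.add_apply] at h3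
  rw [integral_add (hc2.integrable_of_hasCompactSupport (.of_compactSpace _))
    (hc1.integrable_of_hasCompactSupport (.of_compactSpace _))] at h3
  rw [h1, h2]
  linarith

/-- The trigonometric mode as an element of `H¹(Ω)`. -/
def modeH1 {d : ℕ} (z : ℂ) (k : Fin d → ℤ) : H1 d :=
  ⟨WithLp.toLp 1 (modeL2 z k, WithLp.toLp 1 fun i => (2 * π * k i) • modeL2 (-Complex.I * z) k),
    fun i => isWeakPDeriv_modeL2 z k i⟩

theorem toL2_modeH1 {d : ℕ} (z : ℂ) (k : Fin d → ℤ) : H1.toL2 (modeH1 z k) = modeL2 z k := rfl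

theorem grad_modeH1 {d : ℕ} (z : ℂ) (k : Fin d → ℤ) (i : Fin d) :
    H1.grad (modeH1 z k) i = (2 * π * k i) • modeL2 (-Complex.I * z) k := rfl

/-- The trigonometric coefficients of a weak partial derivative. -/
theorem inner_grad_modeL2 {d : ℕ} (u : H1 d) (i : Fin d) (z : ℂ) (k : Fin d → ℤ) :
    inner ℝ (H1.grad u i) (modeL2 z k)
      = -(2 * π * k i * inner ℝ (H1.toL2 u) (modeL2 (-Complex.I * z) k)) := by
  have h : ∫ x, H1.toL2 u x * pderiv i (mode z k) x ∂(vol d)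
      = -∫ x, H1.grad u i x * mode z k x ∂(vol d) := u.2 i _ (isSmooth_mode z k)
  simp only [pderiv_mode] at h
  rw [inner_modeL2, inner_modeL2, ← integral_const_mul, ← neg_eq_iff_eq_neg, ← h]
  exact integral_congr_ae (Filter.Eventually.of_forall fun x => by ring)

/-- The eigenvalue of `-Δ` on the modes of frequency `k`. -/
def eigenvalue {d : ℕ} (k : Fin d → ℤ) : ℝ := ∑ i, (2 * π * k i) ^ 2

theorem eigenvalue_nonneg {d : ℕ} (k : Fin d → ℤ) : 0 ≤ eigenvalue k :=
  Finset.sum_nonneg fun _ _ => sq_nonneg _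

theorem sum_inner_grad_modeH1 {d : ℕ} (u : H1 d) (z : ℂ) (k : Fin d → ℤ) :
    ∑ i, inner ℝ (H1.grad u i) (H1.grad (modeH1 z k) i)
      = eigenvalue k * inner ℝ (H1.toL2 u) (modeL2 z k) := by
  have hz : -Complex.I * (-Complex.I * z) = -z := by
    linear_combination z * Complex.I_mul_I
  rw [eigenvalue, Finset.sum_mul]
  refine Finset.sum_congr rfl fun i _ => ?_
  rw [grad_modeH1, real_inner_smul_right, inner_grad_modeL2, hz, modeL2_neg, inner_neg_right]
  ring

/-- Bessel's inequality for `u` and its weak derivatives together. -/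
theorem sum_eigenvalue_mul_inner_modeL2_sq_le {d : ℕ} (u : H1 d) (F : Finset (Fin d → ℤ)) :
    ∑ k ∈ F, (1 + eigenvalue k) * (inner ℝ (H1.toL2 u) (modeL2 1 k) ^ 2
      + inner ℝ (H1.toL2 u) (modeL2 Complex.I k) ^ 2) ≤ ‖u‖ ^ 2 := by
  have hk (k : Fin d → ℤ) : eigenvalue k * (inner ℝ (H1.toL2 u) (modeL2 1 k) ^ 2
      + inner ℝ (H1.toL2 u) (modeL2 Complex.I k) ^ 2)
      = ∑ i, (inner ℝ (H1.grad u i) (modeL2 1 k) ^ 2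
        + inner ℝ (H1.grad u i) (modeL2 Complex.I k) ^ 2) := by
    rw [eigenvalue, Finset.sum_mul]
    refine Finset.sum_congr rfl fun i _ => ?_
    have hI : -Complex.I * Complex.I = 1 := by simp
    rw [inner_grad_modeL2, inner_grad_modeL2, hI, mul_one, modeL2_neg, inner_neg_right]
    ring
  simp only [add_mul, one_mul, hk, Finset.sum_add_distrib (s := F)]
  rw [Finset.sum_comm, H1.norm_eq]
  have h0 := sum_inner_modeL2_sq_le (H1.toL2 u) F
  have h1 : ∑ i, ∑ k ∈ F, (inner ℝ (H1.grad u i) (modeL2 1 k) ^ 2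
      + inner ℝ (H1.grad u i) (modeL2 Complex.I k) ^ 2) ≤ ∑ i, ‖H1.grad u i‖ ^ 2 :=
    Finset.sum_le_sum fun i _ => sum_inner_modeL2_sq_le _ F
  have h2 : ∑ i, ‖H1.grad u i‖ ^ 2 ≤ (∑ i, ‖H1.grad u i‖) ^ 2 :=
    Finset.sum_sq_le_sq_sum_of_nonneg fun i _ => norm_nonneg _
  have h3 : 0 ≤ ∑ i, ‖H1.grad u i‖ := Finset.sum_nonneg fun i _ => norm_nonneg _
  simp only [← Finset.sum_add_distrib (s := F)]
  nlinarith [norm_nonneg (H1.toL2 u)]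

/-! ### Integration by parts in time up to the initial time -/

/-- The derivatives of smooth cutoffs rising from `0` to `1` on `[1/n, 2/n]` form an approximate
identity at the left endpoint of `[0, T]`. -/
theorem tendsto_integral_deriv_cutoff_mul {T : ℝ} (hT : 0 < T) {F : ℝ → ℝ}
    (hF : ContinuousOn F (Icc 0 T)) :
    Tendsto (fun n : ℕ => ∫ t in Ioo 0 T,
      deriv (fun s => smoothTransition ((n : ℝ) * s - 1)) t * F t) atTop (𝓝 (F 0)) := by
  have hC (n : ℕ) : ContDiff ℝ ∞ (fun s : ℝ => smoothTransition ((n : ℝ) * s - 1)) :=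
    Real.smoothTransition.contDiff.comp (by fun_prop)
  have hmono (n : ℕ) : Monotone (fun s : ℝ => smoothTransition ((n : ℝ) * s - 1)) :=
    Real.smoothTransition.monotone.comp fun a b hab => by gcongr
  have hcont (n : ℕ) : Continuous (deriv fun s : ℝ => smoothTransition ((n : ℝ) * s - 1)) :=
    (hC n).continuous_deriv (by simp)
  rw [Metric.tendsto_atTop]
  intro ε hε
  obtain ⟨δ, hδ, hFδ⟩ := Metric.continuousWithinAt_iff.1
    (hF 0 (left_mem_Icc.2 hT.le)) (ε / 2) (by positivity)
  obtain ⟨N, hN⟩ := exists_nat_gt (max (2 / δ) (2 / T))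
  refine ⟨N, fun n hn => ?_⟩
  have hnN : (N : ℝ) ≤ n := by exact_mod_cast hn
  have h1 : 2 / δ < n := ((le_max_left _ _).trans_lt hN).trans_le hnN
  have h2 : 2 / T < n := ((le_max_right _ _).trans_lt hN).trans_le hnN
  rw [div_lt_iff₀ hδ] at h1
  rw [div_lt_iff₀ hT] at h2
  have hn0 : (0 : ℝ) < n := by
    by_contra h
    nlinarith
  set c := deriv (fun s => smoothTransition ((n : ℝ) * s - 1)) with hc
  have hint1 : IntegrableOn c (Ioo 0 T) :=
    ((hcont n).integrableOn_Icc).mono_set Ioo_subset_Icc_self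
  have hintF : IntegrableOn (fun t => c t * F t) (Ioo 0 T) :=
    (((hcont n).continuousOn.mul hF).integrableOn_Icc).mono_set Ioo_subset_Icc_self
  have hone : ∫ t in Ioo 0 T, c t = 1 := by
    rw [← integral_Ioc_eq_integral_Ioo, ← intervalIntegral.integral_of_le hT.le,
      intervalIntegral.integral_deriv_eq_sub
        (fun x _ => (hC n).differentiable (by simp) x) ((hcont n).intervalIntegrable _ _),
      Real.smoothTransition.one_of_one_le (by linarith),
      Real.smoothTransition.zero_of_nonpos (by simp), sub_zero]
  have hsplit : ∫ t in Ioo 0 T, c t * F t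
      = F 0 + ∫ t in Ioo 0 T, c t * (F t - F 0) := by
    simp only [mul_sub]
    rw [integral_sub hintF (hint1.mul_const _), integral_mul_const, hone]
    ring
  have hbound : ‖∫ t in Ioo 0 T, c t * (F t - F 0)‖ ≤ ∫ t in Ioo 0 T, c t * (ε / 2) := by
    refine norm_integral_le_of_norm_le (hint1.mul_const _) ?_
    refine (ae_restrict_iff' measurableSet_Ioo).2 (Eventually.of_forall fun t ht => ?_)
    have hc0 : 0 ≤ c t := (hmono n).deriv_nonneg
    rw [norm_mul, Real.norm_of_nonneg hc0]
    rcases lt_or_ge t δ with htδ | htδ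
    · refine mul_le_mul_of_nonneg_left ?_ hc0
      have := hFδ (Ioo_subset_Icc_self ht) (by simpa [abs_of_pos ht.1] using htδ)
      rw [Real.dist_eq] at this
      exact this.le
    · -- beyond `δ > 2 / n` the cutoff is identically one
      have : c t = 0 := by
        have he : (fun s : ℝ => smoothTransition ((n : ℝ) * s - 1)) =ᶠ[𝓝 t] fun _ => 1 := by
          have : ∀ᶠ s in 𝓝 t, 2 < (n : ℝ) * s :=
            (continuous_const.mul continuous_id).continuousAt.eventually_const_lt
              (show 2 < (n : ℝ) * t by nlinarith)
          filter_upwards [this] with s hs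
          exact Real.smoothTransition.one_of_one_le (by linarith)
        rw [hc, he.deriv_eq, deriv_const]
      simp [this]
  rw [integral_mul_const, hone, one_mul] at hbound
  rw [hsplit, Real.dist_eq, add_sub_cancel_left]
  exact hbound.trans_lt (by linarith)

/-- Integration by parts for a weak derivative `g` of a function `f` continuous up to the initial
time, against a smooth function that does not vanish at the initial time. -/
theorem integral_add_integral_eq_of_weakDeriv {T : ℝ} (hT : 0 < T) {f g : ℝ → ℝ}
    (hf : ContinuousOn f (Icc 0 T)) (hg : IntegrableOn g (Ioo 0 T))
    (hfg : ∀ ψ : ℝ → ℝ, ContDiff ℝ ∞ ψ → HasCompactSupport ψ → tsupport ψ ⊆ Ioo 0 T →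
      ∫ t in Ioo 0 T, deriv ψ t * f t = -∫ t in Ioo 0 T, ψ t * g t)
    {θ : ℝ → ℝ} (hθ : ContDiff ℝ ∞ θ) {a : ℝ} (ha : a < T) (hθa : ∀ t, a ≤ t → θ t = 0) :
    (∫ t in Ioo 0 T, deriv θ t * f t) + ∫ t in Ioo 0 T, θ t * g t = -(θ 0 * f 0) := by
  have hC (n : ℕ) : ContDiff ℝ ∞ (fun s : ℝ => smoothTransition ((n : ℝ) * s - 1)) :=
    Real.smoothTransition.contDiff.comp (by fun_prop)
  have hcont (n : ℕ) : Continuous (deriv fun s : ℝ => smoothTransition ((n : ℝ) * s - 1)) :=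
    (hC n).continuous_deriv (by simp)
  have hθ' : Continuous (deriv θ) := hθ.continuous_deriv (by simp)
  have hθg : IntegrableOn (fun t => θ t * g t) (Ioo 0 T) := by
    have := (hg.congr_set_ae Ioo_ae_eq_Icc.symm).continuousOn_mul hθ.continuous.continuousOn
      isCompact_Icc
    exact this.mono_set Ioo_subset_Icc_self
  have hθf : IntegrableOn (fun t => deriv θ t * f t) (Ioo 0 T) :=
    ((hθ'.continuousOn.mul hf).integrableOn_Icc).mono_set Ioo_subset_Icc_self
  -- multiplication by the cutoffs disappears in the limit
  have hlim (p : ℝ → ℝ) (hp : IntegrableOn p (Ioo 0 T)) :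
      Tendsto (fun n : ℕ => ∫ t in Ioo 0 T, smoothTransition ((n : ℝ) * t - 1) * p t) atTop
        (𝓝 (∫ t in Ioo 0 T, p t)) := by
    refine tendsto_integral_of_dominated_convergence (fun t => ‖p t‖)
      (fun n => (hC n).continuous.aestronglyMeasurable.mul hp.aestronglyMeasurable) hp.norm
      (fun n => Eventually.of_forall fun t => ?_) ?_
    · rw [norm_mul, Real.norm_of_nonneg (Real.smoothTransition.nonneg _)]
      exact mul_le_of_le_one_left (norm_nonneg _) (Real.smoothTransition.le_one _)
    · refine (ae_restrict_iff' measurableSet_Ioo).2 (Eventually.of_forall fun t ht => ?_)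
      refine tendsto_const_nhds.congr' ?_
      obtain ⟨N, hN⟩ := exists_nat_gt (2 / t)
      filter_upwards [eventually_ge_atTop N] with n hn
      have hnN : (N : ℝ) ≤ n := by exact_mod_cast hn
      have := hN.trans_le hnN
      rw [div_lt_iff₀ ht.1] at this
      rw [Real.smoothTransition.one_of_one_le (by linarith), one_mul]
  have key : ∀ᶠ n : ℕ in atTop,
      (∫ t in Ioo 0 T, smoothTransition ((n : ℝ) * t - 1) * (deriv θ t * f t))
        + (∫ t in Ioo 0 T, deriv (fun s => smoothTransition ((n : ℝ) * s - 1)) t * (θ t * f t))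
        + ∫ t in Ioo 0 T, smoothTransition ((n : ℝ) * t - 1) * (θ t * g t) = 0 := by
    filter_upwards [eventually_gt_atTop 0] with n hn
    have hn0 : (0 : ℝ) < n := by exact_mod_cast hn
    have hzero : ∀ t, t ∉ Icc (1 / (n : ℝ)) a →
        θ t * smoothTransition ((n : ℝ) * t - 1) = 0 := by
      intro t ht
      rcases le_or_gt (1 / (n : ℝ)) t with h1 | h1
      · have : a ≤ t := by
          by_contra h
          exact ht ⟨h1, (not_le.1 h).le⟩
        rw [hθa t this, zero_mul]
      · rw [lt_div_iff₀ hn0] at h1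
        rw [Real.smoothTransition.zero_of_nonpos (by linarith), mul_zero]
    have hsupp : tsupport (fun t => θ t * smoothTransition ((n : ℝ) * t - 1))
        ⊆ Icc (1 / (n : ℝ)) a :=
      closure_minimal (fun t ht => by_contra fun h => ht (hzero t h)) isClosed_Icc
    have h := hfg (fun t => θ t * smoothTransition ((n : ℝ) * t - 1)) (hθ.mul (hC n))
      (HasCompactSupport.intro isCompact_Icc hzero)
      (hsupp.trans fun t ht => ⟨lt_of_lt_of_le (by positivity) ht.1, ht.2.trans_lt ha⟩)
    have hderiv (t : ℝ) : deriv (fun t => θ t * smoothTransition ((n : ℝ) * t - 1)) t * f t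
        = smoothTransition ((n : ℝ) * t - 1) * (deriv θ t * f t)
          + deriv (fun s => smoothTransition ((n : ℝ) * s - 1)) t * (θ t * f t) := by
      rw [deriv_fun_mul (hθ.differentiable (by simp) t) ((hC n).differentiable (by simp) t)]
      ring
    simp only [hderiv] at h
    rw [integral_add] at h
    · rw [h, neg_add_eq_zero]
      exact integral_congr_ae (Eventually.of_forall fun t => by ring)
    · exact (((hC n).continuous.continuousOn.mul
        (hθ'.continuousOn.mul hf)).integrableOn_Icc).mono_set Ioo_subset_Icc_self
    · exact (((hcont n).continuousOn.mul
        (hθ.continuous.continuousOn.mul hf)).integrableOn_Icc).mono_set Ioo_subset_Icc_self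
  have hlim' := ((hlim _ hθf).add (tendsto_integral_deriv_cutoff_mul hT
    (hθ.continuous.continuousOn.mul hf))).add (hlim _ hθg)
  have := tendsto_nhds_unique (tendsto_const_nhds.congr' (key.mono fun n hn => hn.symm)) hlim'
  rw [Pi.mul_apply] at this
  linarith

/-! ### The scalar equation -/

theorem sq_integral_mul_le {α : Type*} [MeasurableSpace α] {μ : Measure α} {p q : α → ℝ}
    (hp : MemLp p 2 μ) (hq : MemLp q 2 μ) :
    (∫ t, p t * q t ∂μ) ^ 2 ≤ (∫ t, p t ^ 2 ∂μ) * ∫ t, q t ^ 2 ∂μ := by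
  have hpq : Integrable (fun t => p t * q t) μ := hp.integrable_mul hq
  have h (x : ℝ) : 0 ≤ (∫ t, p t ^ 2 ∂μ) * (x * x) + (2 * ∫ t, p t * q t ∂μ) * x
      + ∫ t, q t ^ 2 ∂μ := by
    have h0 : 0 ≤ ∫ t, (x * p t + q t) ^ 2 ∂μ := integral_nonneg fun t => sq_nonneg _
    have h1 : ∫ t, (x * p t + q t) ^ 2 ∂μ
        = ∫ t, ((x * x) * p t ^ 2 + (2 * x) * (p t * q t)) + q t ^ 2 ∂μ :=
      integral_congr_ae (Eventually.of_forall fun t => by ring)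
    rw [h1, integral_add (by exact (hp.integrable_sq.const_mul _).add (hpq.const_mul _))
        hq.integrable_sq, integral_add (hp.integrable_sq.const_mul _) (hpq.const_mul _),
      integral_const_mul,
      integral_const_mul] at h0
    linarith
  have := discrim_le_zero h
  rw [discrim] at this
  linarith

theorem memLp_two_of_continuousOn {E : Type*} [NormedAddCommGroup E] {T : ℝ} {f : ℝ → E}
    (hf : ContinuousOn f (Icc 0 T)) : MemLp f 2 (volume.restrict (Ioo 0 T)) := by
  obtain ⟨C, hC⟩ := isCompact_Icc.exists_bound_of_continuousOn hf
  exact MemLp.of_bound ((hf.mono Ioo_subset_Icc_self).aestronglyMeasurable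
    measurableSet_Ioo) C
    ((ae_restrict_iff' measurableSet_Ioo).2 (Eventually.of_forall fun t ht =>
      hC t (Ioo_subset_Icc_self ht)))

/-- Backward observability of the scalar equation `f' = -l f + b`. The factor `1 + l`, rather than
the factor `1 + l ^ 2` that an `l`-independent test function would give, comes from testing with a
cutoff times `exp (-l t)`, since `l ^ 2 * ∫ exp (-2 l t) dt ≤ l / 2`. -/
theorem exists_sq_initial_le (T : ℝ) (hT : 0 < T) :
    ∃ C : ℝ, 0 < C ∧ ∀ (l : ℝ) (f b : ℝ → ℝ), 0 ≤ l → ContinuousOn f (Icc 0 T) →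
      MemLp b 2 (volume.restrict (Ioo 0 T)) →
      (∀ ψ : ℝ → ℝ, ContDiff ℝ ∞ ψ → HasCompactSupport ψ → tsupport ψ ⊆ Ioo 0 T →
        ∫ t in Ioo 0 T, deriv ψ t * f t = -∫ t in Ioo 0 T, ψ t * (b t - l * f t)) →
      f 0 ^ 2 ≤ C * (1 + l) * ((∫ t in Ioo 0 T, f t ^ 2) + ∫ t in Ioo 0 T, b t ^ 2) := by
  set η : ℝ → ℝ := fun t => smoothTransition (2 - 3 * t / T) with hη
  have hηC : ContDiff ℝ ∞ η := Real.smoothTransition.contDiff.comp (by fun_prop)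
  have hη0 : η 0 = 1 := Real.smoothTransition.one_of_one_le (by norm_num)
  have hηT : ∀ t, 2 * T / 3 ≤ t → η t = 0 := fun t ht => by
    refine Real.smoothTransition.zero_of_nonpos ?_
    rw [sub_nonpos, le_div_iff₀ hT]
    linarith
  obtain ⟨K, hK⟩ := (isCompact_Icc (a := (0 : ℝ)) (b := T)).exists_bound_of_continuousOn
    (hηC.continuous_deriv (by simp)).continuousOn
  refine ⟨4 * K ^ 2 * T + 8 + 2 * T, by positivity, fun l f b hl hf hb hweak => ?_⟩
  have hexp (c : ℝ) : ContDiff ℝ ∞ fun t : ℝ => Real.exp (c * t) := by fun_prop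
  have hE (c t : ℝ) : HasDerivAt (fun t : ℝ => Real.exp (c * t)) (c * Real.exp (c * t)) t := by
    simpa [mul_comm] using ((hasDerivAt_id t).const_mul c).exp
  set θ : ℝ → ℝ := fun t => η t * Real.exp (-l * t) with hθ
  have hθC : ContDiff ℝ ∞ θ := hηC.mul (hexp _)
  have hθ' (t : ℝ) : deriv θ t = deriv η t * Real.exp (-l * t) - l * θ t := by
    rw [((hηC.differentiable (by simp) t).hasDerivAt.fun_mul (hE (-l) t)).deriv]
    ring
  have hf2 := memLp_two_of_continuousOn hf
  have hθ2 := memLp_two_of_continuousOn (T := T) hθC.continuous.continuousOn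
  have hp2 : MemLp (fun t => deriv θ t - l * θ t) 2 (volume.restrict (Ioo 0 T)) :=
    memLp_two_of_continuousOn ((hθC.continuous_deriv (by simp)).sub
      (continuous_const.mul hθC.continuous)).continuousOn
  have hd2 := memLp_two_of_continuousOn (T := T) (hθC.continuous_deriv (by simp)).continuousOn
  have hlf : MemLp (fun t => l * f t) 2 (volume.restrict (Ioo 0 T)) := hf2.const_mul l
  have hibp := integral_add_integral_eq_of_weakDeriv hT hf
    (g := fun t => b t - l * f t) ((hb.sub hlf).integrable (by norm_num)) hweak hθC
    (a := 2 * T / 3) (by linarith) (fun t ht => by simp [hθ, hηT t ht])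
  have hf0 : f 0 = -((∫ t in Ioo 0 T, (deriv θ t - l * θ t) * f t)
      + ∫ t in Ioo 0 T, θ t * b t) := by
    have hθ0 : θ 0 = 1 := by simp [hθ, hη0]
    rw [hθ0, one_mul] at hibp
    rw [eq_neg_iff_add_eq_zero, ← neg_eq_iff_add_eq_zero, ← hibp,
      ← integral_add (by exact hd2.integrable_mul hf2) (by exact hθ2.integrable_mul (hb.sub hlf)),
      ← integral_add (by exact hp2.integrable_mul hf2) (by exact hθ2.integrable_mul hb)]
    exact integral_congr_ae (Eventually.of_forall fun t => by ring)
  have hη1 (t : ℝ) : η t ^ 2 ≤ 1 := by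
    have h0 : 0 ≤ η t := Real.smoothTransition.nonneg _
    have h1 : η t ≤ 1 := Real.smoothTransition.le_one _
    nlinarith
  have he1 {t : ℝ} (ht : t ∈ Ioo 0 T) : Real.exp (-l * t) ^ 2 ≤ 1 := by
    have h0 := Real.exp_pos (-l * t)
    have h1 : Real.exp (-l * t) ≤ 1 := Real.exp_le_one_iff.2 (by nlinarith [ht.1])
    nlinarith
  have hsq (t : ℝ) : Real.exp (-l * t) ^ 2 = Real.exp (-(2 * l) * t) := by
    rw [sq, ← Real.exp_add]
    ring_nf
  have hvol : (volume.restrict (Ioo 0 T)).real univ = T := by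
    simp [Measure.real, hT.le]
  have hθint : ∫ t in Ioo 0 T, θ t ^ 2 ≤ T := by
    calc ∫ t in Ioo 0 T, θ t ^ 2 ≤ ∫ t in Ioo 0 T, (1 : ℝ) := by
          refine setIntegral_mono_on hθ2.integrable_sq (integrable_const _) measurableSet_Ioo
            fun t ht => ?_
          rw [hθ, mul_pow]
          exact mul_le_one₀ (hη1 t) (sq_nonneg _) (he1 ht)
      _ = T := by rw [integral_const, hvol, smul_eq_mul, mul_one]
  have hpint : ∫ t in Ioo 0 T, (deriv θ t - l * θ t) ^ 2 ≤ 2 * K ^ 2 * T + 4 * l := by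
    have hei : IntegrableOn (fun t => (2 * l) * Real.exp (-(2 * l) * t)) (Ioo 0 T) :=
      ((continuous_const.mul (hexp _).continuous).integrableOn_Icc).mono_set Ioo_subset_Icc_self
    calc ∫ t in Ioo 0 T, (deriv θ t - l * θ t) ^ 2
        ≤ ∫ t in Ioo 0 T, (2 * K ^ 2 + 4 * l * ((2 * l) * Real.exp (-(2 * l) * t))) := by
          refine setIntegral_mono_on hp2.integrable_sq
            ((integrable_const _).add (hei.const_mul _)) measurableSet_Ioo fun t ht => ?_
          have hKt : deriv η t ^ 2 ≤ K ^ 2 := by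
            have := hK t (Ioo_subset_Icc_self ht)
            rw [Real.norm_eq_abs] at this
            exact sq_le_sq.2 (this.trans (le_abs_self K))
          rw [hθ', ← hsq t]
          have h1 : deriv η t ^ 2 * Real.exp (-l * t) ^ 2 ≤ K ^ 2 := by
            nlinarith [he1 ht, sq_nonneg (Real.exp (-l * t)), sq_nonneg (deriv η t)]
          have h2 : η t ^ 2 * Real.exp (-l * t) ^ 2 ≤ Real.exp (-l * t) ^ 2 :=
            mul_le_of_le_one_left (sq_nonneg _) (hη1 t)
          have h3 : l ^ 2 * (η t ^ 2 * Real.exp (-l * t) ^ 2) ≤ l ^ 2 * Real.exp (-l * t) ^ 2 :=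
            mul_le_mul_of_nonneg_left h2 (sq_nonneg l)
          have h4 := add_sq_le (a := deriv η t * Real.exp (-l * t)) (b := -(2 * l * θ t))
          simp only [hθ] at h4 ⊢
          nlinarith
      _ = 2 * K ^ 2 * T + 4 * l * (1 - Real.exp (-(2 * l) * T)) := by
          rw [integral_add (integrable_const _) (hei.const_mul _), integral_const, hvol,
            integral_const_mul, ← integral_Ioc_eq_integral_Ioo,
            ← intervalIntegral.integral_of_le hT.le,
            intervalIntegral.integral_eq_sub_of_hasDerivAt
              (f := fun t => -Real.exp (-(2 * l) * t))
              (fun t _ => by simpa using (hE (-(2 * l)) t).fun_neg)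
              (by exact (continuous_const.mul (hexp _).continuous).intervalIntegrable _ _)]
          simp
          ring
      _ ≤ 2 * K ^ 2 * T + 4 * l := by
          nlinarith [Real.exp_pos (-(2 * l) * T)]
  have hA : 0 ≤ ∫ t in Ioo 0 T, f t ^ 2 := integral_nonneg fun t => sq_nonneg _
  have hB : 0 ≤ ∫ t in Ioo 0 T, b t ^ 2 := integral_nonneg fun t => sq_nonneg _
  have h1 := (sq_integral_mul_le hp2 hf2).trans (mul_le_mul_of_nonneg_right hpint hA)
  have h2 := (sq_integral_mul_le hθ2 hb).trans (mul_le_mul_of_nonneg_right hθint hB)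
  generalize (∫ t in Ioo 0 T, f t ^ 2) = A at *
  generalize (∫ t in Ioo 0 T, b t ^ 2) = B at *
  have h3 := add_sq_le (a := ∫ t in Ioo 0 T, (deriv θ t - l * θ t) * f t)
    (b := ∫ t in Ioo 0 T, θ t * b t)
  rw [hf0, neg_sq]
  have hKT : 0 ≤ K ^ 2 * T := by positivity
  have hc1 : 4 * K ^ 2 * T + 8 * l ≤ (4 * K ^ 2 * T + 8 + 2 * T) * (1 + l) := by
    nlinarith [mul_nonneg hKT hl, mul_nonneg hT.le hl]
  have hc2 : 2 * T ≤ (4 * K ^ 2 * T + 8 + 2 * T) * (1 + l) := by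
    nlinarith [mul_nonneg hKT hl, mul_nonneg hT.le hl]
  linarith [mul_le_mul_of_nonneg_right hc1 hA, mul_le_mul_of_nonneg_right hc2 hB]

/-! ### Trigonometric coefficients of weak solutions -/

theorem memLp_continuous_mul {d : ℕ} (v : C(Torus d, ℝ)) (f : L2 d) :
    MemLp (fun x => v x * f x) 2 (vol d) :=
  MemLp.of_le_mul (c := ‖v‖) (Lp.memLp f)
    (v.continuous.aestronglyMeasurable.mul (Lp.aestronglyMeasurable f))
    (Eventually.of_forall fun x => by
      rw [norm_mul]
      exact mul_le_mul_of_nonneg_right (v.norm_coe_le_norm x) (norm_nonneg _))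

/-- The product of a continuous function and an `L²` function, as an element of `L²(Ω)`. -/
def continuousMul {d : ℕ} (v : C(Torus d, ℝ)) (f : L2 d) : L2 d := (memLp_continuous_mul v f).toLp

theorem coeFn_continuousMul {d : ℕ} (v : C(Torus d, ℝ)) (f : L2 d) :
    continuousMul v f =ᵐ[vol d] fun x => v x * f x := MemLp.coeFn_toLp _

theorem norm_continuousMul_le {d : ℕ} (v : C(Torus d, ℝ)) (f : L2 d) :
    ‖continuousMul v f‖ ≤ ‖v‖ * ‖f‖ := by
  refine Lp.norm_le_mul_norm_of_ae_le_mul ?_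
  filter_upwards [coeFn_continuousMul v f] with x hx
  rw [hx, norm_mul]
  exact mul_le_mul_of_nonneg_right (v.norm_coe_le_norm x) (norm_nonneg _)

theorem C1TimeNormLE.norm_toFun_le {d : ℕ} {T : ℝ} {V : ℝ → C1 d} {M : ℝ≥0}
    (hV : C1TimeNormLE T V M) {t : ℝ} (ht : t ∈ Ioo 0 T) : ‖C1.toFun (V t)‖ ≤ M := by
  obtain ⟨V', -, hV'⟩ := hV
  have h1 : ‖V t‖ₑ ≤ M :=
    ((le_iSup₂ (f := fun t (_ : t ∈ Ioo 0 T) => ‖V t‖ₑ) t ht).trans le_self_add).trans hV'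
  have h2 : ‖V t‖ ≤ M := NNReal.coe_le_coe.2 (enorm_le_coe.1 h1)
  refine le_trans ?_ h2
  rw [C1.norm_eq]
  exact le_add_of_nonneg_right (Finset.sum_nonneg fun i _ => norm_nonneg _)

theorem toHneg1_apply {d : ℕ} (f : L2 d) (v : H1 d) : toHneg1 f v = inner ℝ f (H1.toL2 v) := rfl

theorem continuous_toHneg1 {d : ℕ} : Continuous (toHneg1 : L2 d → Hneg1 d) :=
  (innerSL ℝ).continuous.clm_comp continuous_const

theorem memLp_dual_apply {α E : Type*} [MeasurableSpace α] [NormedAddCommGroup E]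
    [NormedSpace ℝ E] {μ : Measure α} {p : ℝ≥0∞} {F : α → StrongDual ℝ E} (hF : MemLp F p μ)
    (v : E) : MemLp (fun t => F t v) p μ :=
  (ContinuousLinearMap.apply ℝ ℝ v).comp_memLp' hF

theorem IsWeakTimeDeriv.integral_deriv_mul_dual_apply {E : Type*} [NormedAddCommGroup E]
    [NormedSpace ℝ E] {T : ℝ} {H H' : ℝ → StrongDual ℝ E} (h : IsWeakTimeDeriv T H H')
    (hH : ContinuousOn H (Icc 0 T)) (hH' : MemLp H' 2 (volume.restrict (Ioo 0 T))) (v : E)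
    {ψ : ℝ → ℝ} (hψ : ContDiff ℝ ∞ ψ) (hψc : HasCompactSupport ψ) (hψT : tsupport ψ ⊆ Ioo 0 T) :
    ∫ t in Ioo 0 T, deriv ψ t * H t v = -∫ t in Ioo 0 T, ψ t * H' t v := by
  have hi : IntegrableOn H' (Ioo 0 T) := hH'.integrable (by norm_num)
  have h1 : IntegrableOn (fun t => deriv ψ t • H t) (Ioo 0 T) :=
    (((hψ.continuous_deriv (by simp)).continuousOn.smul hH).integrableOn_Icc).mono_set
      Ioo_subset_Icc_self
  have h2 : IntegrableOn (fun t => ψ t • H' t) (Ioo 0 T) :=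
    ((hi.congr_set_ae Ioo_ae_eq_Icc.symm).continuousOn_smul hψ.continuous.continuousOn
      isCompact_Icc).mono_set Ioo_subset_Icc_self
  have h3 := congrArg (ContinuousLinearMap.apply ℝ ℝ v) (h.2.2 ψ hψ hψc hψT)
  rw [map_neg, ← (ContinuousLinearMap.apply ℝ ℝ v).integral_comp_comm h1,
    ← (ContinuousLinearMap.apply ℝ ℝ v).integral_comp_comm h2] at h3
  simpa only [map_smul, smul_eq_mul, ContinuousLinearMap.apply_apply] using h3

/-- Each trigonometric coefficient of a weak solution solves, in the weak sense, a scalar equation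
`f' = -l f + b`, where `b` is the corresponding coefficient of `V U`. -/
theorem IsWeakSolution.exists_forcing {d : ℕ} {T : ℝ} {V : ℝ → C1 d} {h : H1 d} {U : ℝ → L2 d}
    (hU : IsWeakSolution T V h U) (z : ℂ) (k : Fin d → ℤ) :
    ∃ b : ℝ → ℝ, MemLp b 2 (volume.restrict (Ioo 0 T)) ∧
      (∀ᵐ t ∂(volume.restrict (Ioo 0 T)),
        b t = inner ℝ (continuousMul (C1.toFun (V t)) (U t)) (modeL2 z k)) ∧
      ∀ ψ : ℝ → ℝ, ContDiff ℝ ∞ ψ → HasCompactSupport ψ → tsupport ψ ⊆ Ioo 0 T →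
        ∫ t in Ioo 0 T, deriv ψ t * inner ℝ (U t) (modeL2 z k)
          = -∫ t in Ioo 0 T, ψ t * (b t - eigenvalue k * inner ℝ (U t) (modeL2 z k)) := by
  obtain ⟨u, U', huU, -, hU', hweak, heq⟩ := hU.weak
  have hf : ContinuousOn (fun t => inner ℝ (U t) (modeL2 z k)) (Icc 0 T) :=
    hU.continuousOn.inner continuousOn_const
  have hev : MemLp (fun t => U' t (modeH1 z k)) 2 (volume.restrict (Ioo 0 T)) :=
    memLp_dual_apply hU' (modeH1 z k)
  refine ⟨fun t => U' t (modeH1 z k) + eigenvalue k * inner ℝ (U t) (modeL2 z k),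
    hev.add ((memLp_two_of_continuousOn hf).const_mul _), ?_, fun ψ hψ hψc hψT => ?_⟩
  · filter_upwards [heq (modeH1 z k), huU] with t ht htu
    rw [sum_inner_grad_modeH1, htu, toL2_modeH1] at ht
    have hVU : inner ℝ (continuousMul (C1.toFun (V t)) (U t)) (modeL2 z k)
        = ∫ x, C1.toFun (V t) x * U t x * modeL2 z k x ∂(vol d) := by
      rw [MeasureTheory.L2.inner_def]
      refine integral_congr_ae ?_
      filter_upwards [coeFn_continuousMul (C1.toFun (V t)) (U t)] with x hx
      rw [hx, Real.inner_apply]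
    rw [hVU]
    linarith
  · simp only [add_sub_cancel_right]
    exact hweak.integral_deriv_mul_dual_apply
      (continuous_toHneg1.comp_continuousOn hU.continuousOn) hU' (modeH1 z k) hψ hψc hψT

/-- The inequality dual to `sum_eigenvalue_mul_inner_modeL2_sq_le`, for the initial value of a weak
solution. -/
theorem exists_sum_sq_initial_div_le (T : ℝ) (hT : 0 < T) (M : ℝ≥0) :
    ∃ C : ℝ, 0 < C ∧ ∀ (d : ℕ) (V : ℝ → C1 d), C1TimeNormLE T V M → ∀ (h : H1 d) (U : ℝ → L2 d),
      IsWeakSolution T V h U → ∀ F : Finset (Fin d → ℤ),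
        ∑ k ∈ F, (inner ℝ (H1.toL2 h) (modeL2 1 k) ^ 2
          + inner ℝ (H1.toL2 h) (modeL2 Complex.I k) ^ 2) / (1 + eigenvalue k)
          ≤ C * ∫ t in Ioo 0 T, ‖U t‖ ^ 2 := by
  obtain ⟨C, hC, hCle⟩ := exists_sq_initial_le T hT
  refine ⟨C * (1 + (M : ℝ) ^ 2), by positivity, fun d V hV h U hU F => ?_⟩
  choose b hb2 hbeq hbweak using hU.exists_forcing
  have hUc := hU.continuousOn
  have hf (z : ℂ) (k : Fin d → ℤ) : ContinuousOn (fun t => inner ℝ (U t) (modeL2 z k)) (Icc 0 T) :=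
    hUc.inner continuousOn_const
  have hf2 (z : ℂ) (k : Fin d → ℤ) := (memLp_two_of_continuousOn (hf z k)).integrable_sq
  have hmode (z : ℂ) (k : Fin d → ℤ) :
      inner ℝ (H1.toL2 h) (modeL2 z k) ^ 2 ≤ C * (1 + eigenvalue k) *
        ((∫ t in Ioo 0 T, inner ℝ (U t) (modeL2 z k) ^ 2) + ∫ t in Ioo 0 T, b z k t ^ 2) := by
    have := hCle _ _ _ (eigenvalue_nonneg k) (hf z k) (hb2 z k) (hbweak z k)
    rwa [hU.initial] at this
  have hi (z : ℂ) (k : Fin d → ℤ) : IntegrableOn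
      (fun t => inner ℝ (U t) (modeL2 z k) ^ 2 + b z k t ^ 2) (Ioo 0 T) :=
    (hf2 z k).add (hb2 z k).integrable_sq
  have hterm (k : Fin d → ℤ) :
      (inner ℝ (H1.toL2 h) (modeL2 1 k) ^ 2 + inner ℝ (H1.toL2 h) (modeL2 Complex.I k) ^ 2)
        / (1 + eigenvalue k) ≤ C * ∫ t in Ioo 0 T,
          ((inner ℝ (U t) (modeL2 1 k) ^ 2 + b 1 k t ^ 2)
            + (inner ℝ (U t) (modeL2 Complex.I k) ^ 2 + b Complex.I k t ^ 2)) := by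
    have hpos : 0 < 1 + eigenvalue k := by linarith [eigenvalue_nonneg k]
    rw [div_le_iff₀ hpos, integral_add (hi _ _) (hi _ _),
      integral_add (hf2 _ _) (hb2 _ _).integrable_sq,
      integral_add (hf2 _ _) (hb2 _ _).integrable_sq]
    linarith [hmode 1 k, hmode Complex.I k]
  have hUi : IntegrableOn (fun t => ‖U t‖ ^ 2) (Ioo 0 T) :=
    ((hUc.norm.pow 2).integrableOn_Icc).mono_set Ioo_subset_Icc_self
  refine (Finset.sum_le_sum fun k _ => hterm k).trans ?_
  have hi2 (k : Fin d → ℤ) : IntegrableOn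
      (fun t => (inner ℝ (U t) (modeL2 1 k) ^ 2 + b 1 k t ^ 2)
        + (inner ℝ (U t) (modeL2 Complex.I k) ^ 2 + b Complex.I k t ^ 2)) (Ioo 0 T) :=
    (hi _ _).add (hi _ _)
  rw [← Finset.mul_sum, ← integral_finsetSum _ fun k _ => hi2 k, mul_assoc,
    ← integral_const_mul (1 + (M : ℝ) ^ 2)]
  refine mul_le_mul_of_nonneg_left (integral_mono_ae
    (integrable_finsetSum _ fun k _ => hi2 k) (hUi.const_mul _) ?_) hC.le
  have hball : ∀ᵐ t ∂(volume.restrict (Ioo 0 T)), ∀ k ∈ F,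
      b 1 k t = inner ℝ (continuousMul (C1.toFun (V t)) (U t)) (modeL2 1 k) ∧
      b Complex.I k t = inner ℝ (continuousMul (C1.toFun (V t)) (U t)) (modeL2 Complex.I k) :=
    (ae_ball_iff F.countable_toSet).2 fun k _ => (hbeq 1 k).and (hbeq Complex.I k)
  filter_upwards [hball, ae_restrict_mem measurableSet_Ioo] with t ht htT
  have h1 := sum_inner_modeL2_sq_le (U t) F
  have h2 := sum_inner_modeL2_sq_le (continuousMul (C1.toFun (V t)) (U t)) F
  have h3 : ‖continuousMul (C1.toFun (V t)) (U t)‖ ^ 2 ≤ (M * ‖U t‖) ^ 2 :=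
    pow_le_pow_left₀ (norm_nonneg _) ((norm_continuousMul_le _ _).trans
      (mul_le_mul_of_nonneg_right (hV.norm_toFun_le htT) (norm_nonneg _))) 2
  calc _ = ∑ k ∈ F, (inner ℝ (U t) (modeL2 1 k) ^ 2 + inner ℝ (U t) (modeL2 Complex.I k) ^ 2)
        + ∑ k ∈ F, (inner ℝ (continuousMul (C1.toFun (V t)) (U t)) (modeL2 1 k) ^ 2
          + inner ℝ (continuousMul (C1.toFun (V t)) (U t)) (modeL2 Complex.I k) ^ 2) := by
        rw [← Finset.sum_add_distrib]
        refine Finset.sum_congr rfl fun k hk => ?_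
        rw [(ht k hk).1, (ht k hk).2]
        ring
    _ ≤ ‖U t‖ ^ 2 + (M * ‖U t‖) ^ 2 := add_le_add h1 (h2.trans h3)
    _ = (1 + (M : ℝ) ^ 2) * ‖U t‖ ^ 2 := by ring

/-- The dual norm is controlled by the trigonometric coefficients weighted by `1 / (1 + l)`. -/
theorem norm_toHneg1_sq_le {d : ℕ} (f : L2 d) {B : ℝ}
    (hB : ∀ F : Finset (Fin d → ℤ), ∑ k ∈ F, (inner ℝ f (modeL2 1 k) ^ 2
      + inner ℝ f (modeL2 Complex.I k) ^ 2) / (1 + eigenvalue k) ≤ B) :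
    ‖toHneg1 f‖ ^ 2 ≤ B := by
  have hB0 : 0 ≤ B := by simpa using hB ∅
  have hpos (k : Fin d → ℤ) : 0 < 1 + eigenvalue k := by linarith [eigenvalue_nonneg k]
  have hbound (v : H1 d) : ‖toHneg1 f v‖ ≤ √B * ‖v‖ := by
    have hsum := hasSum_inner_modeL2 f (H1.toL2 v)
    rw [toHneg1_apply]
    refine le_of_tendsto hsum.norm (Eventually.of_forall fun F => ?_)
    refine abs_le_of_sq_le_sq ?_ (mul_nonneg (Real.sqrt_nonneg B) (norm_nonneg v))
    rw [mul_pow, Real.sq_sqrt hB0]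
    refine (Finset.sum_sq_le_sum_mul_sum_of_sq_le_mul F
      (fun k _ => div_nonneg (by positivity) (hpos k).le)
      (fun k _ => mul_nonneg (hpos k).le (by positivity)) fun k _ => ?_).trans
      (mul_le_mul (hB F) (sum_eigenvalue_mul_inner_modeL2_sq_le v F)
        (Finset.sum_nonneg fun k _ => mul_nonneg (hpos k).le (by positivity)) hB0)
    rw [← mul_assoc, div_mul_cancel₀ _ (hpos k).ne']
    nlinarith [sq_nonneg (inner ℝ f (modeL2 1 k) * inner ℝ (H1.toL2 v) (modeL2 Complex.I k)
      - inner ℝ f (modeL2 Complex.I k) * inner ℝ (H1.toL2 v) (modeL2 1 k))]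
  have hnorm : ‖toHneg1 f‖ ≤ √B :=
    ContinuousLinearMap.opNorm_le_bound (toHneg1 f) (Real.sqrt_nonneg B) hbound
  exact (Real.le_sqrt (norm_nonneg (toHneg1 f)) hB0).1 hnorm

end TorusParabolic

end

theorem lemma3p11 (d : ℕ) (hd : 1 ≤ d) (T : ℝ) (hT : 0 < T) (M : ℝ≥0) :
    ∃ c : ℝ, 0 < c ∧
      ∀ V : ℝ → TorusParabolic.C1 d, TorusParabolic.C1TimeNormLE T V M →
        ∀ (h : TorusParabolic.H1 d) (U : ℝ → TorusParabolic.L2 d),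
          TorusParabolic.IsWeakSolution T V h U →
            c * ‖TorusParabolic.toHneg1 (TorusParabolic.H1.toL2 h)‖ ^ 2
              ≤ ∫ s in (0 : ℝ)..T, ‖U s‖ ^ 2 := by
  obtain ⟨C, hC, hle⟩ := TorusParabolic.exists_sum_sq_initial_div_le T hT M
  refine ⟨C⁻¹, inv_pos.2 hC, fun V hV h U hU => ?_⟩
  rw [inv_mul_le_iff₀ hC, intervalIntegral.integral_of_le hT.le, integral_Ioc_eq_integral_Ioo]
  exact TorusParabolic.norm_toHneg1_sq_le _ (hle d V hV h U hU)
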